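/- Let $A=\mathbb{C}^n$ be a finite-dimensional Hilbert space, let $B$ be a second copy of $\mathbb{C}^n$, and write $L(A)$ for the operators on $A$; $X\le Y$ means that $Y-X$ is positive semidefinite. A \emph{non-commutative graph} is a linear subspace $S\subseteq L(A)$ with $S=S^\dagger$ and $I\in S$. Let $|\Phi\rangle=\sum_i |i\rangle\otimes|i\rangle\in A\otimes B$. For $W\ge 0$ in $L(A)$ put $|\sqrt W\rangle=(\sqrt W\otimes I)|\Phi\rangle$ and $$\vartheta(S,W)=\min\{\lambda\in\mathbb{R} : Y\in S\otimes L(B),\ \operatorname{Tr}_A Y\le\lambda I,\ Y\ge |\sqrt W\rangle\langle\sqrt W|\}.$$ The \emph{theta body} of $S$ is $$\mathrm{TH}(S)=\{X\ge 0 : \operatorname{Tr}(XW)\le 1 \text{ for all } W\ge 0 \text{ with } \vartheta(S,W)\le 1\}.$$ For a set $\mathcal{C}$ of positive semidefinite operators on $A$, its \emph{anti-blocker} is $\mathcal{C}^\sharp=\{B\ge 0 : \operatorname{Tr}(AB)\le 1 \text{ for all } A\in\mathcal{C}\}$, its \emph{hereditary closure} is $\mathrm{her}(\mathcal{C})=\{A\ge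 0 : A\le B \text{ for some } B\in\mathcal{C}\}$, and the convex corner \emph{generated} by $\mathcal{C}$ is $\mathrm{her}(\overline{\mathrm{conv}}(\mathcal{C}))$. A convex corner is \emph{finitely generated} if it is generated by a finite set of positive semidefinite operators. An orthogonal projection $P\in L(A)$ is \emph{$S$-full} if $P\,L(A)\,P\subseteq S$, and $\mathrm{FP}(S)$ denotes the convex corner generated by the set of all $S$-full projections. Theorem. Let $S\subseteq L(A)$ be a non-commutative graph. If $\mathrm{TH}^\sharp(S)=\mathrm{TH}(S)^\sharp$ is finitely generated, then $\mathrm{TH}^\sharp(S)=\mathrm{FP}(S)$. -/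

import Mathlib

open scoped MatrixOrder Kronecker Matrix

namespace NCGraph

/-!
The Hilbert space `A` is `ℂⁿ` with an arbitrary finite index type `n`, so that operators on `A`
are `n × n` complex matrices, and `B` is a second copy of `ℂⁿ`.  Operators on `A ⊗ B` are matrices
indexed by `n × n`, the first component belonging to `A` and the second to `B`.
With `MatrixOrder` open, `X ≤ Y` is the Loewner order: `Y - X` is positive semidefinite.
-/

variable {n : Type*} [Fintype n] [DecidableEq n]

/-- A non-commutative graph: a linear space of operators closed under the adjoint and containing
the identity. -/
structure IsNoncommGraph (S : Submodule ℂ (Matrix n n ℂ)) : Prop where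
  conjTranspose_mem : ∀ X ∈ S, Xᴴ ∈ S
  one_mem : (1 : Matrix n n ℂ) ∈ S

/-! ### Convex corners -/

/-- The hereditary closure of a set of positive semidefinite matrices. -/
def her (C : Set (Matrix n n ℂ)) : Set (Matrix n n ℂ) :=
  {A | 0 ≤ A ∧ ∃ B ∈ C, A ≤ B}

/-- The convex corner generated by a set of positive semidefinite matrices: the hereditary closure
of the closure of the convex hull. -/
def cornerGeneratedBy (C : Set (Matrix n n ℂ)) : Set (Matrix n n ℂ) :=
  her (closure (convexHull ℝ C))

/-- `C` is generated, as a convex corner, by a finite set of positive semidefinite matrices. -/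
def FinitelyGenerated (C : Set (Matrix n n ℂ)) : Prop :=
  ∃ F : Set (Matrix n n ℂ), F.Finite ∧ (∀ X ∈ F, 0 ≤ X) ∧ C = cornerGeneratedBy F

/-- The anti-blocker `C^♯`.  (The trace of a product of two positive semidefinite matrices is
real, so taking the real part only changes the type.) -/
def antiblocker (C : Set (Matrix n n ℂ)) : Set (Matrix n n ℂ) :=
  {B | 0 ≤ B ∧ ∀ A ∈ C, (A * B).trace.re ≤ 1}

/-! ### The weighted theta function -/

/-- The space `S ⊗ L(B)` of operators on `A ⊗ B`. -/
def tensorFull (S : Submodule ℂ (Matrix n n ℂ)) : Submodule ℂ (Matrix (n × n) (n × n) ℂ) :=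
  Submodule.span ℂ {Y | ∃ X ∈ S, ∃ M : Matrix n n ℂ, Y = X ⊗ₖ M}

/-- The partial trace over `A`. -/
def traceA (Y : Matrix (n × n) (n × n) ℂ) : Matrix n n ℂ :=
  Matrix.of fun j j' => ∑ i, Y (i, j) (i, j')

/-- The vector `|Φ⟩ = ∑ᵢ |i⟩ ⊗ |i⟩`. -/
def Phi : n × n → ℂ :=
  fun p => if p.1 = p.2 then 1 else 0

/-- The vectorization `|M⟩ = (M ⊗ I) |Φ⟩`. -/
def vectorize (M : Matrix n n ℂ) : n × n → ℂ :=
  (M ⊗ₖ (1 : Matrix n n ℂ)) *ᵥ Phi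

/-- The rank-one operator `|v⟩⟨v|`. -/
def ketbra (v : n × n → ℂ) : Matrix (n × n) (n × n) ℂ :=
  Matrix.vecMulVec v (star v)

/-- The values `l` feasible for the semidefinite program defining `theta S W`: there is
`Y ∈ S ⊗ L(B)` with `Tr_A Y ≤ l I` and `Y ≥ |√W⟩⟨√W|`. -/
def thetaFeasible (S : Submodule ℂ (Matrix n n ℂ)) (W : Matrix n n ℂ) : Set ℝ :=
  {l | ∃ Y ∈ tensorFull S,
    traceA Y ≤ l • (1 : Matrix n n ℂ) ∧ ketbra (vectorize (CFC.sqrt W)) ≤ Y}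

/-- The weighted theta function of a non-commutative graph, for positive semidefinite `W`.
The feasible set is nonempty (`c I ⊗ I` is feasible for large `c`) and, when `n` is nonempty, its
elements are nonnegative; the infimum is the minimum. -/
noncomputable def theta (S : Submodule ℂ (Matrix n n ℂ)) (W : Matrix n n ℂ) : ℝ :=
  sInf (thetaFeasible S W)

/-- The theta body of a non-commutative graph. -/
def thetaBody (S : Submodule ℂ (Matrix n n ℂ)) : Set (Matrix n n ℂ) :=
  {X | 0 ≤ X ∧ ∀ W : Matrix n n ℂ, 0 ≤ W → theta S W ≤ 1 → (X * W).trace.re ≤ 1}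

/-! ### Full projections -/

/-- `P` is an `S`-full projection: an orthogonal projection with `P L(A) P ⊆ S`. -/
def IsFullProjection (S : Submodule ℂ (Matrix n n ℂ)) (P : Matrix n n ℂ) : Prop :=
  IsStarProjection P ∧ ∀ M : Matrix n n ℂ, P * M * P ∈ S

/-- The convex corner `FP(S)` generated by the `S`-full projections. -/
def FP (S : Submodule ℂ (Matrix n n ℂ)) : Set (Matrix n n ℂ) :=
  cornerGeneratedBy {P | IsFullProjection S P}

end NCGraph

section
open scoped ComplexOrder Pointwise

namespace NCGraph

variable {n : Type*} [Fintype n] [DecidableEq n]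

/-! ### Positive semidefinite matrices and the trace pairing -/

/-! Call M feasible if some Y ∈ S ⊗ L(B) has Tr_A Y ≤ 1 and |M⟩⟨M| ≤ Y. For X ≥ 0, TH^♯ and the
matrices M Mᴴ with M feasible have the same supremum of Tr(X ·), and compactness attains it at some
M. A full projection P is feasible through Y = |P⟩⟨P|, which gives FP ⊆ TH^♯.

For the converse, suppose W ∈ TH^♯ lies outside FP and separate it by a positive definite X₀. Among
the finitely many generators pick a maximizer A of X₀, and perturb X₀ to X so that A is the strict
maximizer. Then A is a vertex: it stays optimal on TH^♯ under small Hermitian perturbations of X,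
which forces A = M Mᴴ for an optimal feasible M.

Write Y = |M⟩⟨M| + ∑ |N_k⟩⟨N_k|. The same Y certifies the normalized rotations of M towards N_k, so
optimality makes a first-order term vanish, and at a vertex it does so for enough functionals to
give M N_kᴴ = 0 (`mul_conjTranspose_eq_zero_of_vertex`). Slicing Y on the B side then yields A T A ∈
S for all T, so the range projection P of A is full and A ≤ P (`exists_isFullProjection_ge`). Hence
X₀ is at least as large at P as at W, contradicting separation. -/

theorem exists_eq_conjTranspose_mul_self {m : Type*} [Fintype m] [DecidableEq m]
    {A : Matrix m m ℂ} (hA : 0 ≤ A) : ∃ B : Matrix m m ℂ, A = Bᴴ * B := by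
  obtain ⟨B, hB⟩ := CStarAlgebra.nonneg_iff_eq_star_mul_self.1 hA
  exact ⟨B, hB⟩

theorem conjTranspose_mul_self_nonneg {m k : Type*} [Fintype m] [Fintype k]
    (B : Matrix m k ℂ) : 0 ≤ Bᴴ * B :=
  (Matrix.posSemidef_conjTranspose_mul_self B).nonneg

theorem self_mul_conjTranspose_nonneg {m k : Type*} [Fintype m] [Fintype k]
    (B : Matrix m k ℂ) : 0 ≤ B * Bᴴ :=
  (Matrix.posSemidef_self_mul_conjTranspose B).nonneg

theorem trace_re_nonneg {m : Type*} [Fintype m] {A : Matrix m m ℂ} (hA : 0 ≤ A) :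
    0 ≤ A.trace.re :=
  (Complex.le_def.1 (Matrix.nonneg_iff_posSemidef.1 hA).trace_nonneg).1

theorem trace_re_le_card {m : Type*} [Fintype m] [DecidableEq m] {A : Matrix m m ℂ} (h : A ≤ 1) :
    A.trace.re ≤ Fintype.card m := by
  have := trace_re_nonneg (sub_nonneg.2 h)
  rw [Matrix.trace_sub, Matrix.trace_one, Complex.sub_re, Complex.natCast_re] at this
  linarith

theorem trace_mul_re_nonneg {X A : Matrix n n ℂ} (hX : 0 ≤ X) (hA : 0 ≤ A) :
    0 ≤ (X * A).trace.re := by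
  obtain ⟨B, rfl⟩ := exists_eq_conjTranspose_mul_self hA
  rw [← mul_assoc, Matrix.trace_mul_comm, ← mul_assoc]
  exact trace_re_nonneg ((Matrix.nonneg_iff_posSemidef.1 hX).mul_mul_conjTranspose_same B).nonneg

theorem trace_mul_re_mono {X A B : Matrix n n ℂ} (hX : 0 ≤ X) (h : A ≤ B) :
    (X * A).trace.re ≤ (X * B).trace.re := by
  have := trace_mul_re_nonneg hX (sub_nonneg.2 h)
  rw [mul_sub, Matrix.trace_sub, Complex.sub_re] at this
  linarith

omit [DecidableEq n] in
theorem continuous_trace_mul_re (X : Matrix n n ℂ) :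
    Continuous fun V : Matrix n n ℂ => (X * V).trace.re :=
  Complex.continuous_re.comp (Continuous.matrix_trace (continuous_const.matrix_mul continuous_id))

omit [DecidableEq n] in
theorem trace_mul_self_re_pos {D : Matrix n n ℂ} (hD : D.IsHermitian) (h0 : D ≠ 0) :
    0 < (D * D).trace.re := by
  have h : 0 ≤ Dᴴ * D := conjTranspose_mul_self_nonneg D
  rw [hD.eq] at h
  refine lt_of_le_of_ne (trace_re_nonneg h) fun h1 => h0 ?_
  have h2 : (D * D).trace = 0 :=
    Complex.ext h1.symm (Complex.le_def.1 (Matrix.nonneg_iff_posSemidef.1 h).trace_nonneg).2.symm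
  rw [(Matrix.nonneg_iff_posSemidef.1 h).trace_eq_zero_iff] at h2
  have h3 : Dᴴ * D = 0 := by rw [hD.eq, h2]
  exact Matrix.conjTranspose_mul_self_eq_zero.1 h3

theorem isClosed_nonneg_matrix {m : Type*} [Fintype m] :
    IsClosed {A : Matrix m m ℂ | 0 ≤ A} := by
  have : {A : Matrix m m ℂ | 0 ≤ A} = {A | Aᴴ = A} ∩ ⋂ x : m → ℂ, {A | 0 ≤ star x ⬝ᵥ (A *ᵥ x)} := by
    ext A
    simp only [Set.mem_ofPred_eq, Matrix.nonneg_iff_posSemidef,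
      Matrix.posSemidef_iff_dotProduct_mulVec, Set.mem_inter_iff, Set.mem_iInter,
      Matrix.IsHermitian]
  rw [this]
  refine (isClosed_eq (by fun_prop) continuous_id).inter (isClosed_iInter fun x => ?_)
  have hc : Continuous fun A : Matrix m m ℂ => star x ⬝ᵥ (A *ᵥ x) :=
    continuous_const.dotProduct (continuous_id.matrix_mulVec continuous_const)
  simp only [Complex.le_def, Complex.zero_re, Complex.zero_im]
  exact (isClosed_le continuous_const (Complex.continuous_re.comp hc)).inter
    (isClosed_eq continuous_const (Complex.continuous_im.comp hc))

theorem isCompact_entries_le (m k : Type*) (c : ℝ) :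
    IsCompact {A : Matrix m k ℂ | ∀ i j, ‖A i j‖ ≤ c} := by
  have h := isCompact_univ_pi fun _ : m => isCompact_univ_pi fun _ : k =>
    isCompact_closedBall (0 : ℂ) c
  have he : {A : Matrix m k ℂ | ∀ i j, ‖A i j‖ ≤ c} =
      Set.univ.pi fun _ : m => Set.univ.pi fun _ : k => Metric.closedBall (0 : ℂ) c := by
    apply Set.ext
    intro A
    refine ⟨fun hA i _ j _ => by simpa using hA i j, fun hA i j => ?_⟩
    simpa using hA i trivial j trivial
  rw [he]
  exact h

theorem convex_entries_le (m k : Type*) (c : ℝ) :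
    Convex ℝ {A : Matrix m k ℂ | ∀ i j, ‖A i j‖ ≤ c} := by
  intro A hA B hB a b ha hb hab i j
  calc ‖(a • A + b • B) i j‖ ≤ ‖a • A i j‖ + ‖b • B i j‖ := norm_add_le _ _
    _ ≤ a * c + b * c := by
      rw [norm_smul, norm_smul, Real.norm_of_nonneg ha, Real.norm_of_nonneg hb]
      exact add_le_add (mul_le_mul_of_nonneg_left (hA i j) ha)
        (mul_le_mul_of_nonneg_left (hB i j) hb)
    _ = c := by rw [← add_mul, hab, one_mul]

/-- The principal minor on {i, j} gives |A i j|² ≤ A i i · A j j, and each diagonal entry is at most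
the trace. This supplies all the boundedness used for compactness. -/
theorem norm_apply_le_trace {m : Type*} [Fintype m] [DecidableEq m] {A : Matrix m m ℂ}
    (hA : 0 ≤ A) (i j : m) : ‖A i j‖ ≤ A.trace.re := by
  have hd : ∀ i, 0 ≤ (A i i).re := fun i =>
    (Complex.le_def.1 ((Matrix.nonneg_iff_posSemidef.1 hA).diag_nonneg (i := i))).1
  have hi : ∀ i, (A i i).im = 0 := fun i =>
    (Complex.le_def.1 ((Matrix.nonneg_iff_posSemidef.1 hA).diag_nonneg (i := i))).2.symm
  have hle : ∀ i, (A i i).re ≤ A.trace.re := fun i => by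
    rw [Matrix.trace, Complex.re_sum]
    exact Finset.single_le_sum (f := fun i => (A i i).re) (fun k _ => hd k) (Finset.mem_univ i)
  have hdet := (Complex.le_def.1 ((Matrix.nonneg_iff_posSemidef.1 hA).submatrix ![i, j]).det_nonneg).1
  have hji : A j i = star (A i j) := ((Matrix.nonneg_iff_posSemidef.1 hA).isHermitian.apply j i).symm
  rw [Matrix.det_fin_two] at hdet
  simp only [Matrix.submatrix_apply, Matrix.cons_val_zero, Matrix.cons_val_one, hji,
    Complex.zero_re, Complex.sub_re, Complex.mul_re, hi, mul_zero, sub_zero, Complex.star_def,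
    Complex.conj_re, Complex.conj_im] at hdet
  have hsq : ‖A i j‖ ^ 2 = (A i j).re * (A i j).re + (A i j).im * (A i j).im := by
    rw [Complex.sq_norm, Complex.normSq_apply]
  have ht : 0 ≤ A.trace.re := trace_re_nonneg hA
  have : (A i i).re * (A j j).re ≤ A.trace.re * A.trace.re :=
    mul_le_mul (hle i) (hle j) (hd j) ht
  exact abs_le_of_sq_le_sq' (by nlinarith) ht |>.2

section
open scoped Matrix.Norms.L2Operator

theorem exists_abs_le_smul_one {m : Type*} [Fintype m] [DecidableEq m] {H : Matrix m m ℂ}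
    (hH : H.IsHermitian) :
    ∃ c : ℝ, 0 ≤ c ∧ -(c • (1 : Matrix m m ℂ)) ≤ H ∧ H ≤ c • (1 : Matrix m m ℂ) := by
  have hs : IsSelfAdjoint H := hH
  refine ⟨‖H‖, norm_nonneg _, ?_, ?_⟩
  · have := hs.neg_algebraMap_norm_le_self
    rwa [Algebra.algebraMap_eq_smul_one] at this
  · have := hs.le_algebraMap_norm_self
    rwa [Algebra.algebraMap_eq_smul_one] at this

end

theorem trace_mul_re_smul_right (X V : Matrix n n ℂ) (t : ℝ) :
    (X * (t • V)).trace.re = t * (X * V).trace.re := by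
  rw [mul_smul_comm, Matrix.trace_smul, Complex.smul_re, smul_eq_mul]

theorem trace_mul_re_smul_left (X V : Matrix n n ℂ) (t : ℝ) :
    ((t • X) * V).trace.re = t * (X * V).trace.re := by
  rw [smul_mul_assoc, Matrix.trace_smul, Complex.smul_re, smul_eq_mul]

theorem trace_mul_re_add_right (X V W : Matrix n n ℂ) :
    (X * (V + W)).trace.re = (X * V).trace.re + (X * W).trace.re := by
  rw [mul_add, Matrix.trace_add, Complex.add_re]

theorem trace_mul_re_add_left (X Y V : Matrix n n ℂ) :
    ((X + Y) * V).trace.re = (X * V).trace.re + (Y * V).trace.re := by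
  rw [add_mul, Matrix.trace_add, Complex.add_re]

theorem trace_mul_re_le_of_mem_closure_convexHull {C : Set (Matrix n n ℂ)} {X : Matrix n n ℂ}
    {a : ℝ} (h : ∀ V ∈ C, (X * V).trace.re ≤ a) {V : Matrix n n ℂ}
    (hV : V ∈ closure (convexHull ℝ C)) : (X * V).trace.re ≤ a := by
  have hclosed : IsClosed {V : Matrix n n ℂ | (X * V).trace.re ≤ a} :=
    isClosed_le (continuous_trace_mul_re X) continuous_const
  have hconv : Convex ℝ {V : Matrix n n ℂ | (X * V).trace.re ≤ a} := by
    intro A hA B hB s t hs ht hst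
    simp only [Set.mem_ofPred_eq] at hA hB ⊢
    rw [trace_mul_re_add_right, trace_mul_re_smul_right, trace_mul_re_smul_right]
    calc _ ≤ s * a + t * a := add_le_add (mul_le_mul_of_nonneg_left hA hs)
            (mul_le_mul_of_nonneg_left hB ht)
      _ = a := by rw [← add_mul, hst, one_mul]
  exact closure_minimal (convexHull_min h hconv) hclosed hV

theorem trace_mul_re_le_of_mem_cornerGeneratedBy {C : Set (Matrix n n ℂ)} {X : Matrix n n ℂ}
    (hX : 0 ≤ X) {a : ℝ} (h : ∀ V ∈ C, (X * V).trace.re ≤ a) {V : Matrix n n ℂ}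
    (hV : V ∈ cornerGeneratedBy C) : (X * V).trace.re ≤ a := by
  obtain ⟨-, W, hW, hVW⟩ := hV
  exact (trace_mul_re_mono hX hVW).trans (trace_mul_re_le_of_mem_closure_convexHull h hW)

/-! ### Separation from a convex corner -/

instance : LocallyConvexSpace ℝ (Matrix n n ℂ) :=
  inferInstanceAs (LocallyConvexSpace ℝ (n → n → ℂ))

theorem exists_isHermitian_trace_mul_re_eq (f : Matrix n n ℂ →ₗ[ℝ] ℝ) :
    ∃ X : Matrix n n ℂ, X.IsHermitian ∧
      ∀ H : Matrix n n ℂ, H.IsHermitian → f H = (X * H).trace.re := by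
  obtain ⟨g, hg⟩ : ∃ g : Matrix n n ℂ →ₗ[ℂ] ℂ, ∀ H, (g H).re = f H :=
    ⟨Module.Dual.extendRCLike f, fun H => by simp [Module.Dual.extendRCLike_apply]⟩
  let G : Matrix n n ℂ := Matrix.of fun j i => g (Matrix.single i j 1)
  have hG : ∀ H, g H = (G * H).trace := fun H => by
    conv_lhs => rw [Matrix.matrix_eq_sum_single H]
    simp only [map_sum, Matrix.trace, Matrix.diag, Matrix.mul_apply]
    rw [Finset.sum_comm]
    refine Finset.sum_congr rfl fun j _ => Finset.sum_congr rfl fun i _ => ?_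
    have : Matrix.single i j (H i j) = H i j • Matrix.single i j (1 : ℂ) := by
      rw [Matrix.smul_single, smul_eq_mul, mul_one]
    rw [this, map_smul, smul_eq_mul, mul_comm]
    rfl
  -- The real part of the pairing with a Hermitian matrix sees only the Hermitian part of G.
  refine ⟨(1 / 2 : ℝ) • (G + Gᴴ), ?_, fun H hH => ?_⟩
  · simp [Matrix.IsHermitian, Matrix.conjTranspose_smul, add_comm]
  · have h2 : (Gᴴ * H).trace.re = (G * H).trace.re := by
      have : (Gᴴ * H) = (H * G)ᴴ := by rw [Matrix.conjTranspose_mul, hH.eq]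
      rw [this, Matrix.trace_conjTranspose, Matrix.trace_mul_comm]
      simp
    rw [trace_mul_re_smul_left, trace_mul_re_add_left, h2, ← hg, hG]
    ring

omit [DecidableEq n] in
theorem vecMulVec_star_eq_trace (X : Matrix n n ℂ) (v : n → ℂ) :
    (X * Matrix.vecMulVec v (star v)).trace = star v ⬝ᵥ (X *ᵥ v) := by
  rw [Matrix.mul_vecMulVec, Matrix.trace_vecMulVec, dotProduct_comm]

/-- A positive semidefinite matrix outside the convex corner generated by a bounded set is
separated from it by a positive definite matrix. -/
theorem exists_separating_of_notMem_cornerGeneratedBy {C : Set (Matrix n n ℂ)}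
    (h0 : (0 : Matrix n n ℂ) ∈ C) (hpos : ∀ P ∈ C, 0 ≤ P) (h1 : ∀ P ∈ C, P ≤ 1)
    {W : Matrix n n ℂ} (hW : 0 ≤ W)
    (hWC : W ∉ cornerGeneratedBy C) :
    ∃ (X : Matrix n n ℂ) (e m : ℝ), 0 < e ∧ e • (1 : Matrix n n ℂ) ≤ X ∧
      (∀ P ∈ C, (X * P).trace.re ≤ m) ∧ m < (X * W).trace.re := by
  have htr : ∀ P ∈ C, P.trace.re ≤ Fintype.card n := fun P hP => trace_re_le_card (h1 P hP)
  have hc : ∀ P ∈ C, ∀ i j, ‖P i j‖ ≤ (Fintype.card n : ℝ) := fun P hP i j =>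
    (norm_apply_le_trace (hpos P hP) i j).trans (htr P hP)
  set Q := closure (convexHull ℝ C)
  have hQc : IsCompact Q := by
    refine (isCompact_entries_le n n (Fintype.card n)).of_isClosed_subset isClosed_closure ?_
    exact closure_minimal (convexHull_min hc (convex_entries_le n n _))
      (isCompact_entries_le n n (Fintype.card n)).isClosed
  have hQ0 : (0 : Matrix n n ℂ) ∈ Q := subset_closure (subset_convexHull ℝ C h0)
  -- Adding the negative semidefinite cone makes the separated set downward closed; this is what
  -- forces the functional to be positive.
  let N : Set (Matrix n n ℂ) := {A | 0 ≤ -A}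
  have hNcl : IsClosed N := isClosed_nonneg_matrix.preimage continuous_neg
  have hNconv : Convex ℝ N := by
    intro A hA B hB s t hs ht _
    have : -(s • A + t • B) = s • (-A) + t • (-B) := by simp [add_comm]
    simp only [N, Set.mem_ofPred_eq, this] at hA hB ⊢
    exact add_nonneg (smul_nonneg hs hA) (smul_nonneg ht hB)
  have hDcl : IsClosed (Q + N) := hNcl.add_left_of_isCompact hQc
  have hDconv : Convex ℝ (Q + N) := (convex_convexHull ℝ C).closure.add hNconv
  have hWD : W ∉ Q + N := by
    rintro ⟨A, hA, B, hB, rfl⟩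
    refine hWC ⟨hW, A, hA, ?_⟩
    rw [← sub_nonneg]
    simpa [N] using hB
  obtain ⟨f, u, hfu, huW⟩ := geometric_hahn_banach_closed_point hDconv hDcl hWD
  obtain ⟨X, hXh, hX⟩ := exists_isHermitian_trace_mul_re_eq (f : Matrix n n ℂ →ₗ[ℝ] ℝ)
  have hu0 : 0 < u := by
    simpa using hfu 0 ⟨0, hQ0, 0, by simp [N], by simp⟩
  have hX0 : 0 ≤ X := by
    rw [Matrix.nonneg_iff_posSemidef, Matrix.posSemidef_iff_dotProduct_mulVec]
    refine ⟨hXh, fun v => ?_⟩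
    have hvh := Matrix.posSemidef_vecMulVec_self_star v
    have hre : 0 ≤ f (Matrix.vecMulVec v (star v)) := by
      by_contra hneg
      push Not at hneg
      set z := f (Matrix.vecMulVec v (star v)) with hz
      -- This negative multiple of v v† lies in the cone, yet `f` takes exactly the value `u` on it.
      have := hfu ((-(-u / z)) • - (-(Matrix.vecMulVec v (star v))))
        ⟨0, hQ0, _, ?_, zero_add _⟩
      · rw [neg_neg, map_smul, ← hz, smul_eq_mul, neg_mul, div_mul_cancel₀ _ hneg.ne] at this
        simp at this
      · simp only [N, Set.mem_ofPred_eq, neg_neg, neg_smul]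
        exact smul_nonneg (div_nonneg_of_nonpos (by linarith) hneg.le) hvh.nonneg
    rw [← vecMulVec_star_eq_trace]
    have him : ((X * Matrix.vecMulVec v (star v)).trace).im = 0 := by
      rw [vecMulVec_star_eq_trace]
      exact hXh.im_star_dotProduct_mulVec_self v
    rw [Complex.le_def]
    refine ⟨?_, him.symm⟩
    rw [Complex.zero_re, ← hX _ hvh.1]
    exact hre
  have hPu : ∀ P ∈ C, (X * P).trace.re < u := fun P hP => by
    rw [← hX P (Matrix.nonneg_iff_posSemidef.1 (hpos P hP)).1]
    exact hfu P ⟨P, subset_closure (subset_convexHull ℝ C hP), 0, by simp [N], by simp⟩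
  have hWu : u < (X * W).trace.re := by rwa [← hX W (Matrix.nonneg_iff_posSemidef.1 hW).1]
  set d := (X * W).trace.re - u with hd
  have hd0 : 0 < d := sub_pos.2 hWu
  have hn : (0 : ℝ) < Fintype.card n + 1 := by positivity
  -- Adding e·1 makes X positive definite and raises its value on `C` by at most e times the
  -- dimension, which is less than the gap d.
  have he0 : 0 < d / (Fintype.card n + 1) := div_pos hd0 hn
  have hed : d / (Fintype.card n + 1) * Fintype.card n < d := by
    have : d / (Fintype.card n + 1) * (Fintype.card n + 1) = d := div_mul_cancel₀ _ hn.ne'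
    linarith
  set e := d / (Fintype.card n + 1)
  refine ⟨X + e • 1, e, u + e * Fintype.card n, he0, le_add_of_nonneg_left hX0, fun P hP => ?_, ?_⟩
  · rw [trace_mul_re_add_left, trace_mul_re_smul_left, one_mul]
    exact add_le_add (hPu P hP).le (mul_le_mul_of_nonneg_left (htr P hP) he0.le)
  · rw [trace_mul_re_add_left, trace_mul_re_smul_left, one_mul]
    have := mul_nonneg he0.le (trace_re_nonneg hW)
    linarith

/-! ### Vectorization, partial trace and slices -/

@[simp] theorem vectorize_apply (M : Matrix n n ℂ) (p : n × n) : vectorize M p = M p.1 p.2 := by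
  simp [vectorize, Phi, Matrix.mulVec, dotProduct, Matrix.kroneckerMap_apply, Fintype.sum_prod_type,
    Matrix.one_apply]

theorem vectorize_of (v : n × n → ℂ) : vectorize (Matrix.of fun i j => v (i, j)) = v := by
  ext p; simp

theorem vectorize_add (M N : Matrix n n ℂ) : vectorize (M + N) = vectorize M + vectorize N := by
  ext p; simp

theorem vectorize_smul {R : Type*} [SMul R ℂ] (a : R) (M : Matrix n n ℂ) :
    vectorize (a • M) = a • vectorize M := by
  ext p; simp

theorem continuous_vectorize : Continuous (vectorize : Matrix n n ℂ → n × n → ℂ) := by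
  refine continuous_pi fun p => ?_
  simp only [vectorize_apply]
  exact continuous_id.matrix_elem _ _

theorem one_kronecker_mul_apply (Z : Matrix n n ℂ) (Y : Matrix (n × n) (n × n) ℂ) (i j : n)
    (q : n × n) : (((1 : Matrix n n ℂ) ⊗ₖ Z) * Y) (i, j) q = ∑ b, Z j b * Y (i, b) q := by
  simp [Matrix.mul_apply, Fintype.sum_prod_type, Matrix.kroneckerMap_apply, Matrix.one_apply]

theorem mul_one_kronecker_apply (Z : Matrix n n ℂ) (Y : Matrix (n × n) (n × n) ℂ) (i j : n)
    (q : n × n) : (Y * ((1 : Matrix n n ℂ) ⊗ₖ Z)) q (i, j) = ∑ b, Y q (i, b) * Z b j := by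
  simp [Matrix.mul_apply, Fintype.sum_prod_type, Matrix.kroneckerMap_apply, Matrix.one_apply]

theorem vectorize_mul (M Z : Matrix n n ℂ) :
    vectorize (M * Z) = ((1 : Matrix n n ℂ) ⊗ₖ Zᵀ) *ᵥ vectorize M := by
  ext ⟨i, j⟩
  simp [Matrix.mul_apply, Matrix.mulVec, dotProduct, Fintype.sum_prod_type,
    Matrix.kroneckerMap_apply, Matrix.one_apply, mul_comm]

omit [DecidableEq n] in
theorem ketbra_mulVec (G : Matrix (n × n) (n × n) ℂ) (v : n × n → ℂ) :
    ketbra (G *ᵥ v) = G * ketbra v * Gᴴ := by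
  rw [ketbra, ketbra, Matrix.mul_vecMulVec, Matrix.vecMulVec_mul, Matrix.star_mulVec]

omit [DecidableEq n] in
theorem ketbra_nonneg (v : n × n → ℂ) : 0 ≤ ketbra v :=
  (Matrix.posSemidef_vecMulVec_self_star v).nonneg

omit [Fintype n] [DecidableEq n] in
theorem ketbra_real_smul (a : ℝ) (v : n × n → ℂ) : ketbra (a • v) = a ^ 2 • ketbra v := by
  ext p q
  simp only [ketbra, Matrix.vecMulVec_apply, Matrix.smul_apply, Pi.smul_apply, Pi.star_apply,
    Complex.real_smul, star_mul', Complex.star_def, Complex.conj_ofReal]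
  push_cast
  ring

omit [Fintype n] [DecidableEq n] in
theorem ketbra_I_smul (v : n × n → ℂ) : ketbra (Complex.I • v) = ketbra v := by
  ext p q
  simp only [ketbra, Matrix.vecMulVec_apply, Pi.smul_apply, Pi.star_apply,
    smul_eq_mul, star_mul', Complex.star_def, Complex.conj_I]
  linear_combination (-(v p * (starRingEnd ℂ) (v q))) * Complex.I_mul_I

-- The cross terms of the two rotated vectors cancel. Dropping the second one bounds the first by a
-- multiple of the sum.
omit [Fintype n] [DecidableEq n] in
theorem ketbra_add_ketbra_sub (v w : n × n → ℂ) (t : ℝ) :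
    ketbra (v + t • w) + ketbra (t • v - w) = (1 + t ^ 2) • (ketbra v + ketbra w) := by
  ext p q
  simp only [ketbra, Matrix.vecMulVec_apply, Matrix.smul_apply, Matrix.add_apply, Pi.smul_apply,
    Pi.star_apply, Pi.add_apply, Pi.sub_apply, Complex.real_smul, star_mul', star_add, star_sub,
    Complex.star_def, Complex.conj_ofReal]
  push_cast
  ring

omit [DecidableEq n] in
theorem ketbra_add_smul_le (v w : n × n → ℂ) (t : ℝ) :
    ketbra (v + t • w) ≤ (1 + t ^ 2) • (ketbra v + ketbra w) := by
  rw [← ketbra_add_ketbra_sub]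
  exact le_add_of_nonneg_right (ketbra_nonneg _)

omit [Fintype n] [DecidableEq n] in
theorem continuous_ketbra : Continuous (ketbra : (n × n → ℂ) → _) :=
  continuous_id.matrix_vecMulVec continuous_star

omit [DecidableEq n] in
theorem traceA_sub (Y Z : Matrix (n × n) (n × n) ℂ) : traceA (Y - Z) = traceA Y - traceA Z := by
  ext j k; simp [traceA, Finset.sum_sub_distrib]

omit [DecidableEq n] in
theorem traceA_smul (a : ℝ) (Y : Matrix (n × n) (n × n) ℂ) : traceA (a • Y) = a • traceA Y := by
  ext j k; simp [traceA, Finset.mul_sum]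

omit [DecidableEq n] in
theorem traceA_nonneg {Y : Matrix (n × n) (n × n) ℂ} (hY : 0 ≤ Y) : 0 ≤ traceA Y := by
  have h : traceA Y = ∑ i, Y.submatrix (fun j => (i, j)) (fun j => (i, j)) := by
    ext j k; simp [traceA, Matrix.sum_apply]
  rw [h]
  exact Finset.sum_nonneg fun i _ =>
    ((Matrix.nonneg_iff_posSemidef.1 hY).submatrix fun j => (i, j)).nonneg

omit [DecidableEq n] in
theorem traceA_mono {Y Z : Matrix (n × n) (n × n) ℂ} (h : Y ≤ Z) : traceA Y ≤ traceA Z := by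
  have := traceA_nonneg (sub_nonneg.2 h)
  rwa [traceA_sub, sub_nonneg] at this

omit [DecidableEq n] in
theorem trace_traceA (Y : Matrix (n × n) (n × n) ℂ) : (traceA Y).trace = Y.trace := by
  simp only [Matrix.trace, traceA, Matrix.diag, Matrix.of_apply, Fintype.sum_prod_type]
  rw [Finset.sum_comm]

omit [DecidableEq n] in
theorem continuous_traceA : Continuous (traceA : Matrix (n × n) (n × n) ℂ → Matrix n n ℂ) :=
  continuous_matrix fun _ _ => continuous_finsetSum _ fun _ _ => continuous_id.matrix_elem _ _

theorem traceA_conj (Z : Matrix n n ℂ) (Y : Matrix (n × n) (n × n) ℂ) :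
    traceA (((1 : Matrix n n ℂ) ⊗ₖ Z) * Y * ((1 : Matrix n n ℂ) ⊗ₖ Z)ᴴ) = Z * traceA Y * Zᴴ := by
  ext j k
  rw [Matrix.conjTranspose_kronecker, Matrix.conjTranspose_one]
  simp only [traceA, Matrix.of_apply, mul_one_kronecker_apply, one_kronecker_mul_apply]
  simp only [Matrix.mul_apply, Matrix.of_apply, Finset.sum_mul, Finset.mul_sum]
  rw [Finset.sum_comm]
  exact Finset.sum_congr rfl fun _ _ => Finset.sum_comm

theorem traceA_ketbra_vectorize (M : Matrix n n ℂ) :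
    traceA (ketbra (vectorize M)) = (Mᴴ * M)ᵀ := by
  ext j k
  simp [traceA, ketbra, Matrix.vecMulVec_apply, Matrix.mul_apply, mul_comm]

/-- The slice map `id ⊗ φ`, where `φ` is the functional with coefficients `C`. -/
def slice (C : Matrix n n ℂ) : Matrix (n × n) (n × n) ℂ →ₗ[ℂ] Matrix n n ℂ where
  toFun Y := Matrix.of fun i k => ∑ j, ∑ l, C j l * Y (i, j) (k, l)
  map_add' Y Z := by
    ext i k; simp [mul_add, Finset.sum_add_distrib]
  map_smul' a Y := by
    ext i k; simp [Finset.mul_sum, mul_left_comm]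

-- On X ⊗ M the slice is a scalar multiple of X. This brings the constraint on Y back to S.
omit [DecidableEq n] in
theorem slice_mem {S : Submodule ℂ (Matrix n n ℂ)} {Y : Matrix (n × n) (n × n) ℂ}
    (hY : Y ∈ tensorFull S) (C : Matrix n n ℂ) : slice C Y ∈ S := by
  have h : tensorFull S ≤ S.comap (slice C) := by
    refine Submodule.span_le.2 ?_
    rintro _ ⟨X, hX, M, rfl⟩
    have : slice C (X ⊗ₖ M) = (∑ j, ∑ l, C j l * M j l) • X := by
      ext i k
      simp only [slice, Matrix.kroneckerMap_apply, LinearMap.coe_mk, AddHom.coe_mk,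
        Matrix.of_apply, Matrix.smul_apply, smul_eq_mul, Finset.sum_mul]
      exact Finset.sum_congr rfl fun _ _ => Finset.sum_congr rfl fun _ _ => by ring
    simp only [Submodule.comap_coe, Set.mem_preimage, SetLike.mem_coe, this]
    exact S.smul_mem _ hX
  exact h hY

theorem slice_ketbra_vectorize (C M : Matrix n n ℂ) :
    slice C (ketbra (vectorize M)) = M * C * Mᴴ := by
  ext i k
  simp only [slice, ketbra, LinearMap.coe_mk, AddHom.coe_mk, Matrix.of_apply,
    Matrix.vecMulVec_apply, vectorize_apply, Pi.star_apply, Matrix.mul_apply, Finset.sum_mul,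
    Matrix.conjTranspose_apply]
  rw [Finset.sum_comm]
  refine Finset.sum_congr rfl fun _ _ => Finset.sum_congr rfl fun _ _ => ?_
  ring

theorem conj_mem_tensorFull {S : Submodule ℂ (Matrix n n ℂ)} {Y : Matrix (n × n) (n × n) ℂ}
    (hY : Y ∈ tensorFull S) (Z : Matrix n n ℂ) :
    ((1 : Matrix n n ℂ) ⊗ₖ Z) * Y * ((1 : Matrix n n ℂ) ⊗ₖ Z)ᴴ ∈ tensorFull S := by
  unfold tensorFull at hY
  induction hY using Submodule.span_induction with
  | mem Y h =>
    obtain ⟨X, hX, M, rfl⟩ := h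
    refine Submodule.subset_span ⟨X, hX, Z * M * Zᴴ, ?_⟩
    rw [Matrix.conjTranspose_kronecker, Matrix.conjTranspose_one, ← Matrix.mul_kronecker_mul,
      ← Matrix.mul_kronecker_mul, one_mul, mul_one]
  | zero => simp
  | add Y Z _ _ h1 h2 => rw [mul_add, add_mul]; exact Submodule.add_mem _ h1 h2
  | smul a Y _ h => rw [mul_smul_comm, smul_mul_assoc]; exact Submodule.smul_mem _ a h

/-- Expand along matrix units of B: the (j, l) block of |M⟩⟨M| is M E_jl Mᴴ. -/
theorem ketbra_vectorize_mem_tensorFull {S : Submodule ℂ (Matrix n n ℂ)} {M : Matrix n n ℂ}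
    (hM : ∀ T, M * T * Mᴴ ∈ S) : ketbra (vectorize M) ∈ tensorFull S := by
  have h : ketbra (vectorize M) =
      ∑ j, ∑ l, (M * Matrix.single j l 1 * Mᴴ) ⊗ₖ Matrix.single j l (1 : ℂ) := by
    ext ⟨i, j⟩ ⟨k, l⟩
    simp only [Matrix.sum_apply, Matrix.kroneckerMap_apply]
    rw [Finset.sum_eq_single j, Finset.sum_eq_single l]
    · simp [ketbra, Matrix.vecMulVec_apply, Matrix.mul_apply, Matrix.single_apply, ite_and]
    · intro b _ hb
      simp [hb]
    · simp
    · intro b _ hb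
      simp [hb]
    · simp
  rw [h]
  exact Submodule.sum_mem _ fun j _ => Submodule.sum_mem _ fun l _ =>
    Submodule.subset_span ⟨_, hM _, _, rfl⟩

/-! ### Feasible factors -/

/-- The matrices `M` for which `M * Mᴴ` is feasible, with value `1`, in the program defining the
theta function, where `M` takes the place of the square root. -/
def feasibleFactor (S : Submodule ℂ (Matrix n n ℂ)) : Set (Matrix n n ℂ) :=
  {M | ∃ Y ∈ tensorFull S, traceA Y ≤ 1 ∧ ketbra (vectorize M) ≤ Y}

/-- A polar decomposition: Z = Mᴴ W^(-1/2) with W = M Mᴴ, the inverse taken on the support of W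
through the convention 0⁻¹ = 0. -/
theorem exists_cfc_sqrt_eq_mul (M : Matrix n n ℂ) :
    ∃ Z : Matrix n n ℂ, CFC.sqrt (M * Mᴴ) = M * Z ∧ Zᴴ * Z ≤ 1 := by
  set W := M * Mᴴ with hWdef
  have hW : 0 ≤ W := self_mul_conjTranspose_nonneg M
  have hWs : IsSelfAdjoint W := (Matrix.nonneg_iff_posSemidef.1 hW).1
  have hfin : (spectrum ℝ W).Finite := Matrix.finite_real_spectrum
  have hc : ∀ f : ℝ → ℝ, ContinuousOn f (spectrum ℝ W) := fun f => hfin.continuousOn f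
  have hsp : ∀ x ∈ spectrum ℝ W, 0 ≤ x := fun x hx => spectrum_nonneg_of_nonneg hW hx
  set g := cfc (fun x : ℝ => (√x)⁻¹) W with hg
  have hgs : gᴴ = g := cfc_predicate (fun x : ℝ => (√x)⁻¹) W
  have hWg : W * g = cfc (fun x : ℝ => √x) W := by
    conv_lhs => rw [hg, ← cfc_id' ℝ W, cfc_id' ℝ W]
    conv_lhs => enter [1]; rw [← cfc_id' ℝ W]
    rw [← cfc_mul _ _ _ (hc _) (hc _)]
    refine cfc_congr fun x hx => ?_
    rcases eq_or_ne (√x) 0 with h | h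
    · simp [(Real.sqrt_eq_zero (hsp x hx)).1 h]
    · rw [← div_eq_mul_inv, div_eq_iff h, Real.mul_self_sqrt (hsp x hx)]
  refine ⟨Mᴴ * g, ?_, ?_⟩
  · rw [← mul_assoc, ← hWdef, hWg]
    refine CFC.sqrt_unique ?_ (cfc_nonneg fun x _ => Real.sqrt_nonneg x)
    rw [← cfc_mul _ _ _ (hc _) (hc _)]
    conv_rhs => rw [← cfc_id' ℝ W]
    exact cfc_congr fun x hx => Real.mul_self_sqrt (hsp x hx)
  · have : (Mᴴ * g)ᴴ * (Mᴴ * g) = g * (W * g) := by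
      rw [Matrix.conjTranspose_mul, Matrix.conjTranspose_conjTranspose, hgs, hWdef]
      simp only [mul_assoc]
    rw [this, hWg, hg, ← cfc_mul _ _ _ (hc _) (hc _)]
    refine cfc_le_one _ _ fun x _ => ?_
    exact inv_mul_le_one

/-- Replacing M by √(M Mᴴ) = M Z conjugates |M⟩⟨M| by 1 ⊗ Zᵀ. Conjugating Y likewise stays in S ⊗
L(B) and, Z being a contraction, keeps Tr_A Y ≤ 1. -/
theorem theta_le_one {S : Submodule ℂ (Matrix n n ℂ)} {M : Matrix n n ℂ}
    (hM : M ∈ feasibleFactor S) : theta S (M * Mᴴ) ≤ 1 := by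
  obtain ⟨Z, hZ, hZ1⟩ := exists_cfc_sqrt_eq_mul M
  obtain ⟨Y, hYS, hY1, hMY⟩ := hM
  have hfeas : (1 : ℝ) ∈ thetaFeasible S (M * Mᴴ) := by
    refine ⟨_, conj_mem_tensorFull hYS Zᵀ, ?_, ?_⟩
    · rw [traceA_conj, one_smul]
      have h1 : Zᵀ * traceA Y * Zᵀᴴ ≤ Zᵀ * 1 * Zᵀᴴ := by
        rw [← sub_nonneg, ← sub_mul, ← mul_sub]
        exact ((Matrix.nonneg_iff_posSemidef.1 (sub_nonneg.2 hY1)).mul_mul_conjTranspose_same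
          Zᵀ).nonneg
      refine h1.trans ?_
      have h2 : Zᵀ * 1 * Zᵀᴴ = (Zᴴ * Z)ᵀ := by
        rw [mul_one, Matrix.transpose_mul]
        rfl
      rw [h2, ← sub_nonneg, ← Matrix.transpose_one, ← Matrix.transpose_sub]
      exact (Matrix.nonneg_iff_posSemidef.1 (sub_nonneg.2 hZ1)).transpose.nonneg
    · rw [hZ, vectorize_mul, ketbra_mulVec, ← sub_nonneg, ← sub_mul, ← mul_sub]
      exact ((Matrix.nonneg_iff_posSemidef.1 (sub_nonneg.2 hMY)).mul_mul_conjTranspose_same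
        _).nonneg
  -- For empty `n` every real is feasible and `sInf` of the whole line is 0 by convention; otherwise
  -- 0 is the lower bound that `csInf_le` needs.
  rcases isEmpty_or_nonempty n with hn | hn
  · have : thetaFeasible S (M * Mᴴ) = Set.univ := by
      refine Set.eq_univ_of_forall fun l => ⟨0, zero_mem _, ?_, ?_⟩ <;>
        exact (Subsingleton.elim _ _).le
    rw [theta, this, Real.sInf_univ]
    exact zero_le_one
  · refine csInf_le ⟨0, ?_⟩ hfeas
    rintro l ⟨V, -, hV1, hV⟩
    have h : 0 ≤ l • (1 : Matrix n n ℂ) :=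
      (traceA_nonneg ((ketbra_nonneg _).trans hV)).trans hV1
    have i : n := Classical.arbitrary n
    have := (Complex.le_def.1 ((Matrix.nonneg_iff_posSemidef.1 h).diag_nonneg (i := i))).1
    simpa using this

theorem thetaFeasible_nonempty {S : Submodule ℂ (Matrix n n ℂ)} (hS : IsNoncommGraph S)
    (W : Matrix n n ℂ) : (thetaFeasible S W).Nonempty := by
  obtain ⟨c, -, -, hc⟩ := exists_abs_le_smul_one
    (Matrix.nonneg_iff_posSemidef.1 (ketbra_nonneg (vectorize (CFC.sqrt W)))).1
  have h1 : (1 : Matrix (n × n) (n × n) ℂ) ∈ tensorFull S :=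
    Submodule.subset_span ⟨1, hS.one_mem, 1, Matrix.one_kronecker_one.symm⟩
  refine ⟨c * Fintype.card n, c • 1, ?_, ?_, hc⟩
  · rw [← Complex.coe_smul]
    exact Submodule.smul_mem _ _ h1
  · refine le_of_eq ?_
    ext j k
    simp [traceA, Matrix.one_apply, mul_comm]

/-- The slack c > 1 yields a feasible value below c without attaining the infimum; then rescale √W
by c^(-1/2) and Y by c⁻¹. -/
theorem exists_feasibleFactor_of_theta_le {S : Submodule ℂ (Matrix n n ℂ)} (hS : IsNoncommGraph S)
    {W : Matrix n n ℂ} (hW : 0 ≤ W) (hθ : theta S W ≤ 1) {c : ℝ} (hc : 1 < c) :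
    ∃ M ∈ feasibleFactor S, W = c • (M * Mᴴ) := by
  obtain ⟨l, ⟨Y, hYS, hYl, hY⟩, hlc⟩ :=
    exists_lt_of_csInf_lt (thetaFeasible_nonempty hS W) (hθ.trans_lt hc)
  have hc0 : 0 < c := one_pos.trans hc
  have hsq : ((√c)⁻¹) ^ 2 = c⁻¹ := by rw [inv_pow, Real.sq_sqrt hc0.le]
  refine ⟨(√c)⁻¹ • CFC.sqrt W, ⟨c⁻¹ • Y, ?_, ?_, ?_⟩, ?_⟩
  · rw [← Complex.coe_smul]
    exact Submodule.smul_mem _ _ hYS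
  · rw [traceA_smul]
    have h : traceA Y ≤ c • 1 := hYl.trans (smul_le_smul_of_nonneg_right hlc.le zero_le_one)
    have := smul_le_smul_of_nonneg_left h (inv_nonneg.2 hc0.le)
    rwa [smul_smul, inv_mul_cancel₀ hc0.ne', one_smul] at this
  · rw [vectorize_smul, ketbra_real_smul, hsq]
    exact smul_le_smul_of_nonneg_left hY (inv_nonneg.2 hc0.le)
  · have hs : (CFC.sqrt W)ᴴ = CFC.sqrt W :=
      (Matrix.nonneg_iff_posSemidef.1 (CFC.sqrt_nonneg W)).1
    rw [Matrix.conjTranspose_smul, star_trivial, smul_mul_smul_comm, ← sq, hsq, smul_smul,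
      mul_inv_cancel₀ hc0.ne', one_smul, hs, CFC.sqrt_mul_sqrt_self W hW]

/-- The trace of Y is at most the dimension, which bounds its entries, and |M i j|² is a diagonal
entry of |M⟩⟨M| ≤ Y. -/
theorem isCompact_feasiblePairs (S : Submodule ℂ (Matrix n n ℂ)) :
    IsCompact {p : Matrix n n ℂ × Matrix (n × n) (n × n) ℂ |
      p.2 ∈ tensorFull S ∧ 0 ≤ 1 - traceA p.2 ∧ 0 ≤ p.2 - ketbra (vectorize p.1)} := by
  refine ((isCompact_entries_le n n (Fintype.card n + 1)).prod
    (isCompact_entries_le (n × n) (n × n) (Fintype.card n))).of_isClosed_subset ?_ ?_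
  · refine IsClosed.inter ?_ (IsClosed.inter ?_ ?_)
    · exact (Submodule.closed_of_finiteDimensional (tensorFull S)).preimage continuous_snd
    · exact isClosed_nonneg_matrix.preimage
        (continuous_const.sub (continuous_traceA.comp continuous_snd))
    · exact isClosed_nonneg_matrix.preimage
        (continuous_snd.sub (continuous_ketbra.comp (continuous_vectorize.comp continuous_fst)))
  · rintro ⟨M, Y⟩ ⟨-, h1, h2⟩
    have htr : Y.trace.re ≤ Fintype.card n := by
      rw [← trace_traceA]
      exact trace_re_le_card (sub_nonneg.1 h1)
    have hk := ketbra_nonneg (vectorize M)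
    have hY := hk.trans (sub_nonneg.1 h2)
    refine ⟨fun i j => ?_, fun p q => (norm_apply_le_trace hY p q).trans htr⟩
    have h3 := norm_apply_le_trace hk (i, j) (i, j)
    have h4 := trace_re_nonneg h2
    rw [Matrix.trace_sub, Complex.sub_re] at h4
    have h5 : ‖M i j‖ * ‖M i j‖ ≤ Fintype.card n := by
      have h6 : ‖ketbra (vectorize M) (i, j) (i, j)‖ = ‖M i j‖ * ‖M i j‖ := by
        simp [ketbra, Matrix.vecMulVec_apply]
      rw [← h6]
      linarith
    show ‖M i j‖ ≤ Fintype.card n + 1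
    nlinarith [norm_nonneg (M i j)]

theorem exists_feasibleFactor_isMaxOn (S : Submodule ℂ (Matrix n n ℂ)) (X : Matrix n n ℂ) :
    ∃ M ∈ feasibleFactor S, ∀ M' ∈ feasibleFactor S,
      (X * (M' * M'ᴴ)).trace.re ≤ (X * (M * Mᴴ)).trace.re := by
  have hf : Continuous fun p : Matrix n n ℂ × Matrix (n × n) (n × n) ℂ =>
      (X * (p.1 * p.1ᴴ)).trace.re :=
    (continuous_trace_mul_re X).comp
      (continuous_fst.matrix_mul continuous_fst.matrix_conjTranspose)
  obtain ⟨⟨M, Y⟩, ⟨hYS, h1, h2⟩, hmax⟩ := (isCompact_feasiblePairs S).exists_isMaxOn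
    ⟨(0, 0), zero_mem _, by
      have : traceA (0 : Matrix (n × n) (n × n) ℂ) = 0 := by ext; simp [traceA]
      simp [this], by
      have : vectorize (0 : Matrix n n ℂ) = 0 := by ext; simp
      simp [ketbra, this]⟩ hf.continuousOn
  refine ⟨M, ⟨Y, hYS, sub_nonneg.1 h1, sub_nonneg.1 h2⟩, ?_⟩
  rintro M' ⟨Y', hYS', h1', h2'⟩
  exact hmax (a := (M', Y')) ⟨hYS', sub_nonneg.2 h1', sub_nonneg.2 h2'⟩

/-! ### The convex corner `TH^♯` -/

theorem mul_conjTranspose_mem_antiblocker_thetaBody {S : Submodule ℂ (Matrix n n ℂ)}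
    {M : Matrix n n ℂ} (hM : M ∈ feasibleFactor S) :
    M * Mᴴ ∈ antiblocker (thetaBody S) :=
  ⟨self_mul_conjTranspose_nonneg M, fun _ hX =>
    hX.2 _ (self_mul_conjTranspose_nonneg M) (theta_le_one hM)⟩

/-- A linear functional bounded on the feasible matrices `M * Mᴴ` has the same bound on `TH^♯`. -/
theorem trace_mul_re_le_of_mem_antiblocker_thetaBody {S : Submodule ℂ (Matrix n n ℂ)}
    (hS : IsNoncommGraph S) {X : Matrix n n ℂ} (hX : 0 ≤ X) {a : ℝ}
    (h : ∀ M ∈ feasibleFactor S, (X * (M * Mᴴ)).trace.re ≤ a) {V : Matrix n n ℂ}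
    (hV : V ∈ antiblocker (thetaBody S)) : (X * V).trace.re ≤ a := by
  have hzero : (0 : Matrix n n ℂ) ∈ feasibleFactor S :=
    ⟨0, zero_mem _, by
      have : traceA (0 : Matrix (n × n) (n × n) ℂ) = 0 := by ext; simp [traceA]
      simp [this], by
      have : vectorize (0 : Matrix n n ℂ) = 0 := by ext; simp
      simp [ketbra, this]⟩
  have ha : 0 ≤ a := by simpa using h 0 hzero
  -- Normalizing by b > a avoids dividing by a possibly zero a, and leaves room for the factor c > 1
  -- lost in passing from θ ≤ 1 to a feasible M.
  refine le_of_forall_gt_imp_ge_of_dense fun b hb => ?_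
  have hb0 : 0 < b := ha.trans_lt hb
  have hmem : b⁻¹ • X ∈ thetaBody S := by
    refine ⟨smul_nonneg (inv_nonneg.2 hb0.le) hX, fun W hW hθ => ?_⟩
    rw [trace_mul_re_smul_left, inv_mul_le_iff₀ hb0, mul_one]
    refine le_of_forall_gt_imp_ge_of_dense fun d hd => ?_
    obtain ⟨c, hc1, hc⟩ : ∃ c : ℝ, 1 < c ∧ c * a ≤ d := by
      have hd0 : 0 < d := hb0.trans hd
      refine ⟨d / b, (one_lt_div hb0).2 hd, ?_⟩
      rw [div_mul_eq_mul_div, div_le_iff₀ hb0]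
      exact mul_le_mul_of_nonneg_left hb.le hd0.le
    obtain ⟨M, hM, rfl⟩ := exists_feasibleFactor_of_theta_le hS hW hθ hc1
    rw [trace_mul_re_smul_right]
    exact (mul_le_mul_of_nonneg_left (h M hM) (one_pos.trans hc1).le).trans hc
  have := hV.2 _ hmem
  rwa [trace_mul_re_smul_left, inv_mul_le_iff₀ hb0, mul_one] at this

theorem conjTranspose_mul_self_le_one_of_mem_feasibleFactor {S : Submodule ℂ (Matrix n n ℂ)}
    {M : Matrix n n ℂ} (hM : M ∈ feasibleFactor S) : Mᴴ * M ≤ 1 := by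
  obtain ⟨Y, -, hY1, hMY⟩ := hM
  have h := (traceA_mono hMY).trans hY1
  rw [traceA_ketbra_vectorize, ← Matrix.transpose_one, ← sub_nonneg, ← Matrix.transpose_sub] at h
  rw [← sub_nonneg]
  simpa using (Matrix.nonneg_iff_posSemidef.1 h).transpose.nonneg

/-- Both inequalities say ‖M‖ ≤ 1, by the C*-identity. -/
theorem self_mul_conjTranspose_le_one {M : Matrix n n ℂ} (h : Mᴴ * M ≤ 1) : M * Mᴴ ≤ 1 := by
  open scoped Matrix.Norms.L2Operator in
  rw [← CStarAlgebra.norm_le_one_iff_of_nonneg _ (self_mul_conjTranspose_nonneg M)]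
  have h1 := (CStarAlgebra.norm_le_one_iff_of_nonneg _ (conjTranspose_mul_self_nonneg M)).2 h
  rw [← Matrix.star_eq_conjTranspose, CStarRing.norm_star_mul_self] at h1
  rwa [← Matrix.star_eq_conjTranspose, CStarRing.norm_self_mul_star]

/-! ### Full projections -/

theorem IsFullProjection.mem_feasibleFactor {S : Submodule ℂ (Matrix n n ℂ)} {P : Matrix n n ℂ}
    (hP : IsFullProjection S P) : P ∈ feasibleFactor S := by
  have hs : Pᴴ = P := hP.1.isSelfAdjoint
  refine ⟨_, ketbra_vectorize_mem_tensorFull fun T => by rw [hs]; exact hP.2 T, ?_, le_rfl⟩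
  rw [traceA_ketbra_vectorize, hs, hP.1.isIdempotentElem, ← Matrix.transpose_one, ← sub_nonneg,
    ← Matrix.transpose_sub]
  exact (Matrix.nonneg_iff_posSemidef.1 hP.1.one_sub.nonneg).transpose.nonneg

omit [DecidableEq n] in
theorem IsFullProjection.mul_conjTranspose_eq {S : Submodule ℂ (Matrix n n ℂ)}
    {P : Matrix n n ℂ} (hP : IsFullProjection S P) : P * Pᴴ = P := by
  have hs : Pᴴ = P := hP.1.isSelfAdjoint
  rw [hs, hP.1.isIdempotentElem]

theorem isFullProjection_zero (S : Submodule ℂ (Matrix n n ℂ)) :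
    IsFullProjection S (0 : Matrix n n ℂ) :=
  ⟨IsStarProjection.zero _, fun M => by simp⟩

theorem FP_subset_antiblocker_thetaBody (S : Submodule ℂ (Matrix n n ℂ)) :
    FP S ⊆ antiblocker (thetaBody S) := fun V hV =>
  ⟨hV.1, fun X hX => trace_mul_re_le_of_mem_cornerGeneratedBy hX.1 (fun P hP => by
    have := (mul_conjTranspose_mem_antiblocker_thetaBody hP.mem_feasibleFactor).2 X hX
    rwa [hP.mul_conjTranspose_eq] at this) hV⟩

/-- A positive semidefinite contraction `W` with `W * T * W ∈ S` for all `T` lies below an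
`S`-full projection, namely its range projection. -/
theorem exists_isFullProjection_ge {S : Submodule ℂ (Matrix n n ℂ)} {W : Matrix n n ℂ}
    (hW : 0 ≤ W) (hW1 : W ≤ 1) (h : ∀ T, W * T * W ∈ S) :
    ∃ P, IsFullProjection S P ∧ W ≤ P := by
  have hWs : IsSelfAdjoint W := (Matrix.nonneg_iff_posSemidef.1 hW).1
  have hfin : (spectrum ℝ W).Finite := Matrix.finite_real_spectrum
  have hc : ∀ f : ℝ → ℝ, ContinuousOn f (spectrum ℝ W) := fun f => hfin.continuousOn f
  have hid : cfc (fun x : ℝ => x) W = W := cfc_id' ℝ W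
  set g := cfc (fun x : ℝ => x⁻¹) W with hg
  -- Since 0⁻¹ = 0, the function x x⁻¹ is the indicator of x ≠ 0, so P is the range projection.
  set P := cfc (fun x : ℝ => x * x⁻¹) W with hP
  have hPW : P = W * g := by
    rw [hP, cfc_mul _ _ _ (hc _) (hc _), hid]
  have hPW' : P = g * W := by
    rw [hPW, hg]
    conv_lhs => enter [1]; rw [← hid]
    conv_rhs => enter [2]; rw [← hid]
    exact cfc_commute_cfc _ _ _
  refine ⟨P, ⟨⟨?_, cfc_predicate _ W⟩, fun T => ?_⟩, ?_⟩
  · rw [IsIdempotentElem, hP, ← cfc_mul _ _ _ (hc _) (hc _)]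
    refine cfc_congr fun x _ => ?_
    rcases eq_or_ne x 0 with rfl | hx
    · simp
    · simp [hx]
  · have : P * T * P = W * (g * T * g) * W := by
      conv_lhs => enter [2]; rw [hPW']
      rw [hPW]
      simp only [mul_assoc]
    rw [this]
    exact h _
  · rw [hP]
    conv_lhs => rw [← hid]
    refine cfc_mono (fun x hx => ?_) (hc _) (hc _)
    have hx1 : x ≤ 1 := by
      have h1 : W ≤ algebraMap ℝ _ 1 := by simpa using hW1
      exact (le_algebraMap_iff_spectrum_le (r := (1 : ℝ)) (a := W)).1 h1 x hx
    rcases eq_or_ne x 0 with rfl | hx0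
    · simp
    · simpa [hx0] using hx1

/-! ### Optimality at a vertex -/

theorem smul_add_smul_mem_feasibleFactor {S : Submodule ℂ (Matrix n n ℂ)}
    {M N : Matrix n n ℂ} {Y : Matrix (n × n) (n × n) ℂ} (hYS : Y ∈ tensorFull S)
    (hY1 : traceA Y ≤ 1) (hY : ketbra (vectorize M) + ketbra (vectorize N) ≤ Y) (t : ℝ) :
    (√(1 + t ^ 2))⁻¹ • (M + t • N) ∈ feasibleFactor S := by
  have ht : 0 < 1 + t ^ 2 := by positivity
  refine ⟨Y, hYS, hY1, le_trans ?_ hY⟩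
  rw [vectorize_smul, vectorize_add, vectorize_smul, ketbra_real_smul, inv_pow, Real.sq_sqrt ht.le]
  have := smul_le_smul_of_nonneg_left (ketbra_add_smul_le (vectorize M) (vectorize N) t)
    (inv_nonneg.2 ht.le)
  rwa [smul_smul, inv_mul_cancel₀ ht.ne', one_smul] at this

/-- Optimality along the rotation gives t d ≤ t² (a - b) for every real t, so the linear coefficient
d vanishes. -/
theorem trace_mul_cross_terms_re_eq_zero {S : Submodule ℂ (Matrix n n ℂ)}
    {M N X : Matrix n n ℂ} {Y : Matrix (n × n) (n × n) ℂ} (hYS : Y ∈ tensorFull S)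
    (hY1 : traceA Y ≤ 1) (hY : ketbra (vectorize M) + ketbra (vectorize N) ≤ Y)
    (hmax : ∀ M' ∈ feasibleFactor S, (X * (M' * M'ᴴ)).trace.re ≤ (X * (M * Mᴴ)).trace.re) :
    (X * (M * Nᴴ + N * Mᴴ)).trace.re = 0 := by
  set a := (X * (M * Mᴴ)).trace.re with ha
  set b := (X * (N * Nᴴ)).trace.re with hb
  set d := (X * (M * Nᴴ + N * Mᴴ)).trace.re with hd
  have key : ∀ t : ℝ, t * d ≤ t ^ 2 * (a - b) := fun t => by
    have ht : 0 < 1 + t ^ 2 := by positivity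
    have h := hmax _ (smul_add_smul_mem_feasibleFactor hYS hY1 hY t)
    have hexp : (M + t • N) * (M + t • N)ᴴ =
        M * Mᴴ + t • (M * Nᴴ + N * Mᴴ) + t ^ 2 • (N * Nᴴ) := by
      rw [Matrix.conjTranspose_add, Matrix.conjTranspose_smul, star_trivial, add_mul, mul_add,
        mul_add, smul_mul_assoc, smul_mul_assoc, mul_smul_comm, mul_smul_comm, smul_add,
        smul_smul, ← sq]
      abel
    rw [Matrix.conjTranspose_smul, star_trivial, smul_mul_smul_comm, ← sq, inv_pow,
      Real.sq_sqrt ht.le, trace_mul_re_smul_right, inv_mul_le_iff₀ ht, hexp,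
      trace_mul_re_add_right, trace_mul_re_add_right, trace_mul_re_smul_right,
      trace_mul_re_smul_right] at h
    linarith
  by_contra hne
  rcases le_or_gt (a - b) 0 with hab | hab
  · have h1 := key d
    have : 0 < d * d := mul_self_pos.2 hne
    nlinarith [sq_nonneg d]
  · have h1 := key (d / (2 * (a - b)))
    have h2 : d / (2 * (a - b)) * d = d ^ 2 / (2 * (a - b)) := by ring
    have h3 : (d / (2 * (a - b))) ^ 2 * (a - b) = d ^ 2 / (2 * (a - b)) / 2 := by
      field_simp
    have h4 : 0 < d ^ 2 / (2 * (a - b)) := by positivity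
    rw [h2, h3] at h1
    linarith

theorem mul_conjTranspose_eq_zero_of_vertex {S : Submodule ℂ (Matrix n n ℂ)}
    {M N X : Matrix n n ℂ} {Y : Matrix (n × n) (n × n) ℂ} (hYS : Y ∈ tensorFull S)
    (hY1 : traceA Y ≤ 1) (hY : ketbra (vectorize M) + ketbra (vectorize N) ≤ Y)
    (hmax : ∀ M' ∈ feasibleFactor S, (X * (M' * M'ᴴ)).trace.re ≤ (X * (M * Mᴴ)).trace.re)
    (hvertex : ∀ H : Matrix n n ℂ, H.IsHermitian → ∃ s : ℝ, 0 < s ∧ ∀ M' ∈ feasibleFactor S,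
      ((X + s • H) * (M' * M'ᴴ)).trace.re ≤ ((X + s • H) * (M * Mᴴ)).trace.re) :
    M * Nᴴ = 0 := by
  have cross : ∀ N : Matrix n n ℂ, ketbra (vectorize M) + ketbra (vectorize N) ≤ Y →
      M * Nᴴ + N * Mᴴ = 0 := fun N hN => by
    by_contra hne
    have hD : (M * Nᴴ + N * Mᴴ).IsHermitian := by
      simp [Matrix.IsHermitian, Matrix.conjTranspose_mul, add_comm]
    -- Perturb in the direction of the cross term itself: its pairing with X and with X + sH both
    -- vanish, hence so does its Hilbert-Schmidt norm.
    obtain ⟨s, hs, hsmax⟩ := hvertex _ hD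
    have h1 := trace_mul_cross_terms_re_eq_zero hYS hY1 hN hmax
    have h2 := trace_mul_cross_terms_re_eq_zero hYS hY1 hN hsmax
    rw [trace_mul_re_add_left, trace_mul_re_smul_left, h1, zero_add] at h2
    exact (mul_pos hs (trace_mul_self_re_pos hD hne)).ne' h2
  have h1 := cross N hY
  -- A phase does not change |N⟩⟨N|, so iN is allowed too and isolates M Nᴴ from its adjoint.
  have h2 := cross (Complex.I • N) (by rwa [vectorize_smul, ketbra_I_smul])
  rw [Matrix.conjTranspose_smul, mul_smul_comm, smul_mul_assoc, Complex.star_def,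
    Complex.conj_I, neg_smul, ← smul_neg, ← smul_add, smul_eq_zero] at h2
  have h3 := h2.resolve_left Complex.I_ne_zero
  have h4 : M * Nᴴ = -(N * Mᴴ) := eq_neg_of_add_eq_zero_left h1
  have h5 : M * Nᴴ = N * Mᴴ := by rwa [neg_add_eq_zero] at h3
  have h6 : M * Nᴴ + M * Nᴴ = 0 := by nth_rw 2 [h5]; exact h1
  rwa [← two_smul ℂ, smul_eq_zero, or_iff_right two_ne_zero] at h6

/-- A matrix `M * Mᴴ` at which the feasible set has a vertex lies below an `S`-full projection. -/
theorem exists_isFullProjection_ge_of_vertex {S : Submodule ℂ (Matrix n n ℂ)}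
    {M X : Matrix n n ℂ} (hM : M ∈ feasibleFactor S)
    (hmax : ∀ M' ∈ feasibleFactor S, (X * (M' * M'ᴴ)).trace.re ≤ (X * (M * Mᴴ)).trace.re)
    (hvertex : ∀ H : Matrix n n ℂ, H.IsHermitian → ∃ s : ℝ, 0 < s ∧ ∀ M' ∈ feasibleFactor S,
      ((X + s • H) * (M' * M'ᴴ)).trace.re ≤ ((X + s • H) * (M * Mᴴ)).trace.re) :
    ∃ P, IsFullProjection S P ∧ M * Mᴴ ≤ P := by
  have hM1 := conjTranspose_mul_self_le_one_of_mem_feasibleFactor hM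
  obtain ⟨Y, hYS, hY1, hMY⟩ := hM
  obtain ⟨B, hB⟩ := exists_eq_conjTranspose_mul_self (sub_nonneg.2 hMY)
  -- The conjugated rows of B split Y - |M⟩⟨M| into rank-one terms.
  let N : n × n → Matrix n n ℂ := fun k => Matrix.of fun i j => star (B k (i, j))
  have hN : ∀ k, vectorize (N k) = star (B k) := fun k => vectorize_of (star (B k))
  have hsum : Y = ketbra (vectorize M) + ∑ k, ketbra (vectorize (N k)) := by
    rw [← sub_eq_iff_eq_add', hB]
    ext p q
    simp only [hN, Matrix.sum_apply, ketbra, Matrix.vecMulVec_apply, Matrix.mul_apply,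
      Matrix.conjTranspose_apply, star_star, Pi.star_apply]
  have hle : ∀ k, ketbra (vectorize M) + ketbra (vectorize (N k)) ≤ Y := fun k => by
    conv_rhs => rw [hsum]
    exact add_le_add le_rfl (Finset.single_le_sum (f := fun k => ketbra (vectorize (N k)))
      (fun k _ => ketbra_nonneg _) (Finset.mem_univ k))
  have hMN : ∀ k, N k * Mᴴ = 0 := fun k => by
    have := mul_conjTranspose_eq_zero_of_vertex hYS hY1 (hle k) hmax hvertex
    rw [← Matrix.conjTranspose_eq_zero]
    simpa using this
  refine exists_isFullProjection_ge (self_mul_conjTranspose_nonneg M)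
    (self_mul_conjTranspose_le_one hM1) fun T => ?_
  -- With this coefficient matrix the M-term becomes (M Mᴴ) T (M Mᴴ), and each N_k-term contains N_k
  -- Mᴴ = 0.
  have h := slice_mem hYS (Mᴴ * T * M)
  rw [hsum, map_add, map_sum, slice_ketbra_vectorize, Finset.sum_eq_zero, add_zero] at h
  · simpa only [mul_assoc] using h
  · intro k _
    rw [slice_ketbra_vectorize, ← mul_assoc, ← mul_assoc, hMN]
    simp

/-! ### Finitely many generators -/

/-- Among finitely many matrices maximizing a functional, one of largest Hilbert-Schmidt norm
becomes the strict maximizer after a perturbation of the functional towards it. -/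
theorem exists_strict_maximizer {F : Set (Matrix n n ℂ)} (hF : F.Finite) (hne : F.Nonempty)
    (hpos : ∀ V ∈ F, 0 ≤ V) (X : Matrix n n ℂ) :
    ∃ A ∈ F, (∀ V ∈ F, (X * V).trace.re ≤ (X * A).trace.re) ∧
      ∃ r : ℝ, 0 < r ∧ ∀ V ∈ F, V ≠ A →
        ((X + r • A) * V).trace.re < ((X + r • A) * A).trace.re := by
  obtain ⟨A₀, hA₀, hA₀max⟩ := Set.exists_max_image F (fun V => (X * V).trace.re) hF hne
  obtain ⟨A, ⟨hAF, hAX⟩, hA⟩ := Set.exists_max_image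
    {V | V ∈ F ∧ (X * V).trace.re = (X * A₀).trace.re} (fun V => (V * V).trace.re)
    (hF.subset fun V hV => hV.1) ⟨A₀, hA₀, rfl⟩
  refine ⟨A, hAF, fun V hV => hAX ▸ hA₀max V hV, ?_⟩
  have hev : ∀ V ∈ F, ∀ᶠ r : ℝ in nhdsWithin 0 (Set.Ioi 0), V ≠ A →
      ((X + r • A) * V).trace.re < ((X + r • A) * A).trace.re := fun V hV => by
    rcases (hA₀max V hV).lt_or_eq with hlt | heq
    · have hcont : Continuous fun r : ℝ =>
          ((X + r • A) * A).trace.re - ((X + r • A) * V).trace.re := by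
        simp only [trace_mul_re_add_left, trace_mul_re_smul_left]
        fun_prop
      have h0 : 0 < ((X + (0 : ℝ) • A) * A).trace.re - ((X + (0 : ℝ) • A) * V).trace.re := by
        simpa [hAX] using hlt
      filter_upwards [nhdsWithin_le_nhds (hcont.continuousAt.eventually_const_lt h0)]
        with r hr _
      exact sub_pos.1 hr
    -- On a tie, maximality of ‖A‖ and ‖A - V‖ > 0 give ⟨A, V⟩ < ⟨A, A⟩, so every r > 0 works.
    · filter_upwards [self_mem_nhdsWithin] with r hr hVA
      have hVV := hA V ⟨hV, heq⟩
      have hD : (A - V).IsHermitian := (Matrix.nonneg_iff_posSemidef.1 (hpos A hAF)).1.sub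
        (Matrix.nonneg_iff_posSemidef.1 (hpos V hV)).1
      have hsq := trace_mul_self_re_pos hD (sub_ne_zero.2 hVA.symm)
      have hexp : ((A - V) * (A - V)).trace.re =
          (A * A).trace.re - 2 * (A * V).trace.re + (V * V).trace.re := by
        rw [sub_mul, mul_sub, mul_sub, Matrix.trace_sub, Matrix.trace_sub, Matrix.trace_sub,
          Matrix.trace_mul_comm V A]
        simp only [Complex.sub_re]
        ring
      rw [trace_mul_re_add_left, trace_mul_re_add_left, trace_mul_re_smul_left,
        trace_mul_re_smul_left, heq, hAX]
      have hr0 : (0 : ℝ) < r := hr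
      have : r * (A * V).trace.re < r * (A * A).trace.re :=
        mul_lt_mul_of_pos_left (by linarith) hr0
      linarith
  obtain ⟨r, hr, hr0⟩ := (((Filter.eventually_all_finite hF).2 hev).and
    self_mem_nhdsWithin).exists
  exact ⟨r, hr0, hr⟩

/-- A strict maximizer over a finite set, for a positive definite functional, remains a maximizer
over the convex corner generated by the set when the functional is slightly perturbed. -/
theorem exists_perturbation_maximizer {F : Set (Matrix n n ℂ)} (hF : F.Finite)
    {X A : Matrix n n ℂ} {e : ℝ} (he : 0 < e) (hX : e • (1 : Matrix n n ℂ) ≤ X)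
    (hA : ∀ V ∈ F, V ≠ A → (X * V).trace.re < (X * A).trace.re) {H : Matrix n n ℂ}
    (hH : H.IsHermitian) :
    ∃ s : ℝ, 0 < s ∧ ∀ V ∈ cornerGeneratedBy F,
      ((X + s • H) * V).trace.re ≤ ((X + s • H) * A).trace.re := by
  obtain ⟨c, -, hcH, -⟩ := exists_abs_le_smul_one hH
  have hev : ∀ V ∈ F, ∀ᶠ s : ℝ in nhdsWithin 0 (Set.Ioi 0),
      ((X + s • H) * V).trace.re ≤ ((X + s • H) * A).trace.re := fun V hV => by
    rcases eq_or_ne V A with rfl | hne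
    · exact Filter.Eventually.of_forall fun _ => le_rfl
    · have hcont : Continuous fun s : ℝ =>
          ((X + s • H) * A).trace.re - ((X + s • H) * V).trace.re := by
        simp only [trace_mul_re_add_left, trace_mul_re_smul_left]
        fun_prop
      have h0 : 0 < ((X + (0 : ℝ) • H) * A).trace.re - ((X + (0 : ℝ) • H) * V).trace.re := by
        simpa using hA V hV hne
      filter_upwards [nhdsWithin_le_nhds (hcont.continuousAt.eventually_const_lt h0)] with s hs
      exact (sub_pos.1 hs).le
  -- This keeps X + sH positive semidefinite, so that a bound on `F` passes to the hereditary
  -- closure.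
  have hpos : ∀ᶠ s : ℝ in nhdsWithin 0 (Set.Ioi 0), s * c < e := by
    have hcont : Continuous fun s : ℝ => s * c := by fun_prop
    exact nhdsWithin_le_nhds (hcont.continuousAt.eventually_lt_const (by simpa using he))
  obtain ⟨s, ⟨hsF, hse⟩, hs0⟩ := ((((Filter.eventually_all_finite hF).2 hev).and hpos).and
    self_mem_nhdsWithin).exists
  have hs0 : (0 : ℝ) < s := hs0
  refine ⟨s, hs0, fun V hV => trace_mul_re_le_of_mem_cornerGeneratedBy ?_ hsF hV⟩
  have h1 : s • -(c • (1 : Matrix n n ℂ)) ≤ s • H := smul_le_smul_of_nonneg_left hcH hs0.le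
  have h2 : 0 ≤ (e - s * c) • (1 : Matrix n n ℂ) :=
    smul_nonneg (sub_nonneg.2 hse.le) zero_le_one
  refine h2.trans (le_trans (le_of_eq ?_) (add_le_add hX h1))
  rw [sub_smul, smul_neg, smul_smul, sub_eq_add_neg]

theorem antiblocker_thetaBody_subset_FP {S : Submodule ℂ (Matrix n n ℂ)}
    (hS : IsNoncommGraph S) (hfg : FinitelyGenerated (antiblocker (thetaBody S))) :
    antiblocker (thetaBody S) ⊆ FP S := by
  obtain ⟨F, hFfin, hFpos, hF⟩ := hfg
  intro W hW
  by_contra hWFP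
  obtain ⟨X₀, e, m, he, heX₀, hm, hmW⟩ := exists_separating_of_notMem_cornerGeneratedBy
    (C := {P | IsFullProjection S P}) (isFullProjection_zero S) (fun P hP => hP.1.nonneg)
    (fun P hP => sub_nonneg.1 hP.1.one_sub.nonneg) hW.1 hWFP
  have hX₀ : 0 ≤ X₀ := (smul_nonneg he.le zero_le_one).trans heX₀
  have hWF : W ∈ cornerGeneratedBy F := hF ▸ hW
  have hFne : F.Nonempty := by
    obtain ⟨-, V, hV, -⟩ := hWF
    exact convexHull_nonempty_iff.1 (closure_nonempty_iff.1 ⟨V, hV⟩)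
  obtain ⟨A, hAF, hAmax, r, hr, hstrict⟩ := exists_strict_maximizer hFfin hFne hFpos X₀
  have hA0 : 0 ≤ A := hFpos A hAF
  have hAC : A ∈ antiblocker (thetaBody S) :=
    hF ▸ ⟨hA0, A, subset_closure (subset_convexHull ℝ F hAF), le_rfl⟩
  have heX : e • (1 : Matrix n n ℂ) ≤ X₀ + r • A :=
    heX₀.trans (le_add_of_nonneg_right (smul_nonneg hr.le hA0))
  set X := X₀ + r • A
  have hX : 0 ≤ X := (smul_nonneg he.le zero_le_one).trans heX
  clear_value X
  have hpert : ∀ H : Matrix n n ℂ, H.IsHermitian → ∃ s : ℝ, 0 < s ∧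
      ∀ V ∈ antiblocker (thetaBody S),
        ((X + s • H) * V).trace.re ≤ ((X + s • H) * A).trace.re := fun H hH => by
    rw [hF]
    exact exists_perturbation_maximizer hFfin he heX hstrict hH
  obtain ⟨M, hM, hMmax⟩ := exists_feasibleFactor_isMaxOn S X
  have hMC := mul_conjTranspose_mem_antiblocker_thetaBody hM
  -- M Mᴴ is at least as good as A for X, so perturbing X towards M Mᴴ - A would make it strictly
  -- better, against the vertex property of A.
  have hMA : M * Mᴴ = A := by
    by_contra hne
    have hD : (M * Mᴴ - A).IsHermitian :=
      (Matrix.nonneg_iff_posSemidef.1 (self_mul_conjTranspose_nonneg M)).1.sub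
        (Matrix.nonneg_iff_posSemidef.1 hA0).1
    obtain ⟨s, hs, hsmax⟩ := hpert _ hD
    have h1 := hsmax _ hMC
    have h2 := trace_mul_re_le_of_mem_antiblocker_thetaBody hS hX hMmax hAC
    have h3 := mul_pos hs (trace_mul_self_re_pos hD (sub_ne_zero.2 hne))
    rw [trace_mul_re_add_left, trace_mul_re_add_left, trace_mul_re_smul_left,
      trace_mul_re_smul_left] at h1
    rw [mul_sub, Matrix.trace_sub, Complex.sub_re, mul_sub] at h3
    linarith
  obtain ⟨P, hP, hAP⟩ := exists_isFullProjection_ge_of_vertex hM hMmax fun H hH => by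
    obtain ⟨s, hs, hsmax⟩ := hpert H hH
    refine ⟨s, hs, fun M' hM' => ?_⟩
    rw [hMA]
    exact hsmax _ (mul_conjTranspose_mem_antiblocker_thetaBody hM')
  rw [hMA] at hAP
  -- A also maximizes the unperturbed X₀ on `F`, so the values of X₀ increase along W, A, P.
  have h1 := trace_mul_re_le_of_mem_cornerGeneratedBy hX₀ hAmax hWF
  have h2 := trace_mul_re_mono hX₀ hAP
  have h3 := hm P hP
  linarith

end NCGraph

end

theorem mainTheorem8 {n : Type*} [Fintype n] [DecidableEq n]
    (S : Submodule ℂ (Matrix n n ℂ)) (hS : NCGraph.IsNoncommGraph S)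
    (hfg : NCGraph.FinitelyGenerated (NCGraph.antiblocker (NCGraph.thetaBody S))) :
    NCGraph.antiblocker (NCGraph.thetaBody S) = NCGraph.FP S :=
  (NCGraph.antiblocker_thetaBody_subset_FP hS hfg).antisymm
    (NCGraph.FP_subset_antiblocker_thetaBody S)
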